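/- Let $d\ge 1$, and let $\Phi:\mathbb{R}^d\to\mathbb{R}$ be a truncation function, i.e. a smooth, radially decreasing (that is, $\Phi(y)\le\Phi(x)$ whenever $|x|\le|y|$), nonnegative function supported on $\overline{B(0;2)}$ with $\Phi=1$ on $B(0;1)$. Write $\mathcal{F}[f](\xi)=\int_{\mathbb{R}^d} f(x)\,e^{-2\pi i x\cdot\xi}\,\mathrm{d}x$. Then for every real $a>4$ there exists $\eta_a>0$ such that $$\Big|\mathcal{F}\big[(|x|^a-|x|^4)\Phi(x)\big](\xi)\Big|\le \eta_a\,(1+|\xi|)^{-d-a}\qquad\text{for all }\xi\in\mathbb{R}^d.$$ Furthermore, the numbers $\eta_a$ (which may depend on $d$ and $\Phi$) can be chosen so that $\eta_a=O(a-4)$ as $a\to 4^+$. -/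

import Mathlib

open scoped ContDiff FourierTransform Topology

/-- A truncation function on `ℝ^d`: a smooth, radially decreasing, nonnegative function that is
supported on the closed ball of radius `2` and equal to `1` on the open unit ball. -/
structure IsTruncationFunction {d : ℕ} (Φ : EuclideanSpace ℝ (Fin d) → ℝ) : Prop where
  smooth : ContDiff ℝ ∞ Φ
  nonneg : ∀ x, 0 ≤ Φ x
  /-- `Φ x` is a nonincreasing function of `‖x‖`; in particular `Φ` is radial. -/
  radially_decreasing : ∀ x y, ‖x‖ ≤ ‖y‖ → Φ y ≤ Φ x
  tsupport_subset : tsupport Φ ⊆ Metric.closedBall 0 2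
  eq_one : ∀ x ∈ Metric.ball (0 : EuclideanSpace ℝ (Fin d)) 1, Φ x = 1

/-- The function `x ↦ (|x|^a - |x|^4) Φ(x)` on `ℝ^d`, regarded as complex-valued. -/
noncomputable def truncatedPowerDiff {d : ℕ} (Φ : EuclideanSpace ℝ (Fin d) → ℝ) (a : ℝ) :
    EuclideanSpace ℝ (Fin d) → ℂ :=
  fun x => (((‖x‖ ^ a - ‖x‖ ^ 4) * Φ x : ℝ) : ℂ)

/-!
Write `f_a(x) = (|x| ^ a - |x| ^ m) Φ(x)` with `m` even. Up to a smooth compactly supported error,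
`f_a` is homogeneous of degree `a`: `f_a(x) = 2 ^ (-a) f_a(2x) + K(a, x) - K(m, x)`, where `K` is
smooth in `(a, x)` jointly because `Φ(x) - Φ(2x)` vanishes near the origin and `m` is even. Hence
`|𝓕 f_a(ξ)| ≤ 2 ^ (-(d + a)) |𝓕 f_a(ξ / 2)| + D (1 + |ξ|) ^ (-(d + a) - 1)` with `D = O(|a - m|)`.
The function `2 D (1 + |ξ|) ^ (-(d + a))` is a supersolution of this recursion, whose homogeneous
part is a strict contraction on bounded functions, so it dominates `|𝓕 f_a|`.
-/

open Filter MeasureTheory Metric Module Set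

section DyadicRecursion

lemma nonpos_of_le_mul_comp {α : Type*} {u : α → ℝ} {T : α → α} {c : ℝ} (hc₀ : 0 ≤ c)
    (hc₁ : c < 1) (hbdd : BddAbove (range u)) (hu : ∀ x, u x ≤ c * u (T x)) (x : α) :
    u x ≤ 0 := by
  have : Nonempty α := ⟨x⟩
  have hsup : ⨆ y, u y ≤ c * ⨆ y, u y :=
    ciSup_le fun y => (hu y).trans (mul_le_mul_of_nonneg_left (le_ciSup hbdd _) hc₀)
  have hx : u x ≤ ⨆ y, u y := le_ciSup hbdd x
  nlinarith

lemma rpow_neg_sub_one_add_two_mul_rpow_neg_le {s p : ℝ} (hs : 1 ≤ s) (hp : 1 ≤ p) :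
    s ^ (-p - 1) + 2 * (s + 1) ^ (-p) ≤ 2 * s ^ (-p) := by
  have hs₀ : 0 < s := by linarith
  have hsplit : (s + 1) ^ (-p) = s ^ (-p) * (s / (s + 1)) ^ p := by
    rw [Real.div_rpow hs₀.le (by positivity), Real.rpow_neg hs₀.le, Real.rpow_neg (by positivity)]
    field_simp
  have hratio : (s / (s + 1)) ^ p ≤ s / (s + 1) :=
    Real.rpow_le_self_of_le_one (by positivity) (div_le_one_of_le₀ (by linarith) (by positivity)) hp
  have hsum : s⁻¹ + 2 * (s / (s + 1)) ≤ 2 := by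
    field_simp
    nlinarith
  calc s ^ (-p - 1) + 2 * (s + 1) ^ (-p)
      = s ^ (-p) * (s⁻¹ + 2 * (s / (s + 1)) ^ p) := by
        rw [hsplit, Real.rpow_sub_one hs₀.ne']
        ring
    _ ≤ s ^ (-p) * 2 := by
        gcongr
        linarith
    _ = 2 * s ^ (-p) := mul_comm _ _

lemma le_of_dyadic_recursion {V : Type*} [NormedAddCommGroup V] [NormedSpace ℝ V] {u : V → ℝ}
    {p D : ℝ} (hp : 1 ≤ p) (hD : 0 ≤ D) (hbdd : BddAbove (range u))
    (hrec : ∀ ξ, u ξ ≤ 2 ^ (-p) * u ((2 : ℝ)⁻¹ • ξ) + D * (1 + ‖ξ‖) ^ (-p - 1)) (ξ : V) :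
    u ξ ≤ 2 * D * (1 + ‖ξ‖) ^ (-p) := by
  -- `2 * D * (1 + ‖ξ‖) ^ (-p)` is a supersolution of the recursion.
  refine sub_nonpos.1 (nonpos_of_le_mul_comp (u := fun ξ => u ξ - 2 * D * (1 + ‖ξ‖) ^ (-p))
    (T := ((2 : ℝ)⁻¹ • ·)) (c := 2 ^ (-p)) (by positivity)
    (Real.rpow_lt_one_of_one_lt_of_neg one_lt_two (by linarith)) ?_ (fun ξ => ?_) ξ)
  · obtain ⟨M, hM⟩ := hbdd
    refine ⟨M, forall_mem_range.2 fun ξ => ?_⟩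
    have hu : u ξ ≤ M := hM (mem_range_self ξ)
    have hw : 0 ≤ 2 * D * (1 + ‖ξ‖) ^ (-p) := by positivity
    linarith
  · have hhalf : 2 ^ (-p) * (1 + ‖(2 : ℝ)⁻¹ • ξ‖) ^ (-p) = (1 + ‖ξ‖ + 1) ^ (-p) := by
      rw [← Real.mul_rpow (by norm_num) (by positivity), norm_smul, norm_inv, Real.norm_ofNat]
      ring_nf
    have hsuper := mul_le_mul_of_nonneg_left (rpow_neg_sub_one_add_two_mul_rpow_neg_le
      (le_add_of_nonneg_right (norm_nonneg ξ)) hp) hD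
    linear_combination hrec ξ + hsuper + 2 * D * hhalf

lemma le_mul_rpow_neg_of_pow_mul_le {s y B q : ℝ} {n : ℕ} (hs : 1 ≤ s) (hy : 0 ≤ y)
    (hq : q ≤ n) (h : s ^ n * y ≤ B) : y ≤ B * s ^ (-q) := by
  rw [Real.rpow_neg (by linarith), ← div_eq_mul_inv, le_div_iff₀' (by positivity)]
  refine le_trans ?_ h
  gcongr
  simpa only [Real.rpow_natCast] using Real.rpow_le_rpow_of_exponent_le hs hq

end DyadicRecursion

section ParametricDerivatives

variable {P V F : Type*} [NormedAddCommGroup P] [NormedSpace ℝ P] [NormedAddCommGroup V]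
  [NormedSpace ℝ V] [NormedAddCommGroup F] [NormedSpace ℝ F] {K : P × V → F}

lemma iteratedFDeriv_comp_prodMk_right (hK : ContDiff ℝ ∞ K) (j : ℕ) (a : P) (x : V) :
    iteratedFDeriv ℝ j (fun y => K (a, y)) x =
      (iteratedFDeriv ℝ j K (a, x)).compContinuousLinearMap
        fun _ => ContinuousLinearMap.inr ℝ P V := by
  have hslice : (fun y => K (a, y)) =
      (fun z => K (z + (a, 0))) ∘ ContinuousLinearMap.inr ℝ P V := by
    ext y
    simp
  have hshift : ContDiff ℝ ∞ fun z => K (z + (a, 0)) := by fun_prop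
  rw [hslice, ContinuousLinearMap.iteratedFDeriv_comp_right _ hshift x (mod_cast le_top),
    iteratedFDeriv_comp_add_right]
  simp

lemma contDiff_iteratedFDeriv_comp_prodMk_right (hK : ContDiff ℝ ∞ K) (j : ℕ) :
    ContDiff ℝ ∞ fun z : P × V => iteratedFDeriv ℝ j (fun y => K (z.1, y)) z.2 := by
  simp only [iteratedFDeriv_comp_prodMk_right hK]
  exact (ContinuousMultilinearMap.compContinuousLinearMapL
    fun _ : Fin j => ContinuousLinearMap.inr ℝ P V).contDiff.comp
      (hK.iteratedFDeriv_right (m := ∞) (mod_cast le_top))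

lemma exists_norm_iteratedFDeriv_comp_prodMk_sub_le (hK : ContDiff ℝ ∞ K) {s : Set P} {t : Set V}
    (hs : IsCompact s) (ht : IsCompact t) (n : ℕ) :
    ∃ C, 0 ≤ C ∧ ∀ j ≤ n, ∀ a ∈ s, ∀ b ∈ s, ∀ x ∈ t,
      ‖iteratedFDeriv ℝ j (fun y => K (a, y) - K (b, y)) x‖ ≤ C * ‖a - b‖ := by
  have hlip (j : ℕ) : ∃ L, LipschitzOnWith L
      (fun z : P × V => iteratedFDeriv ℝ j (fun y => K (z.1, y)) z.2) (s ×ˢ t) :=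
    ((contDiff_iteratedFDeriv_comp_prodMk_right hK j).of_le
      (mod_cast le_top)).locallyLipschitz.locallyLipschitzOn.exists_lipschitzOnWith_of_compact
        (hs.prod ht)
  choose L hL using hlip
  refine ⟨∑ j ∈ Finset.range (n + 1), (L j : ℝ), by positivity, fun j hj a ha b hb x hx => ?_⟩
  have hslice (c : P) : ContDiffAt ℝ j (fun y => K (c, y)) x :=
    (hK.comp (contDiff_const.prodMk contDiff_id)).contDiffAt.of_le (mod_cast le_top)
  have hsub : iteratedFDeriv ℝ j (fun y => K (a, y) - K (b, y)) x =
      iteratedFDeriv ℝ j (fun y => K (a, y)) x - iteratedFDeriv ℝ j (fun y => K (b, y)) x :=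
    iteratedFDeriv_sub_apply (hslice a) (hslice b)
  calc ‖iteratedFDeriv ℝ j (fun y => K (a, y) - K (b, y)) x‖
      ≤ L j * ‖((a, x) : P × V) - (b, x)‖ := by
        rw [hsub]
        exact (hL j).norm_sub_le (x := (a, x)) (y := (b, x)) ⟨ha, hx⟩ ⟨hb, hx⟩
    _ = L j * ‖a - b‖ := by simp
    _ ≤ (∑ j ∈ Finset.range (n + 1), (L j : ℝ)) * ‖a - b‖ := by
        gcongr
        exact Finset.single_le_sum (f := fun j => (L j : ℝ)) (fun _ _ => NNReal.coe_nonneg _)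
          (Finset.mem_range_succ_iff.2 hj)

end ParametricDerivatives

section Fourier

variable {V F : Type*} [NormedAddCommGroup V] [InnerProductSpace ℝ V] [FiniteDimensional ℝ V]
  [MeasurableSpace V] [BorelSpace V] [NormedAddCommGroup F] [NormedSpace ℂ F]

lemma norm_fourier_le_integral_norm (f : V → F) (ξ : V) : ‖𝓕 f ξ‖ ≤ ∫ x, ‖f x‖ :=
  VectorFourier.norm_fourierIntegral_le_integral_norm _ _ _ _ _

lemma fourier_add_apply {f g : V → F} (hf : Integrable f) (hg : Integrable g) (ξ : V) :
    𝓕 (f + g) ξ = 𝓕 f ξ + 𝓕 g ξ :=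
  congrFun (VectorFourier.fourierIntegral_add Real.continuous_fourierChar
    (by exact continuous_inner) hf hg) ξ

lemma fourier_real_smul_apply (c : ℝ) (f : V → F) (ξ : V) : 𝓕 (c • f) ξ = c • 𝓕 f ξ :=
  congrFun (VectorFourier.fourierIntegral_const_smul _ _ _ f (c : ℂ)) ξ

lemma fourier_comp_smul_apply {c : ℝ} (hc : c ≠ 0) (f : V → F) (ξ : V) :
    𝓕 (fun x => f (c • x)) ξ = |(c ^ finrank ℝ V)⁻¹| • 𝓕 f (c⁻¹ • ξ) := by
  rw [Real.fourier_eq, Real.fourier_eq, ← Measure.integral_comp_smul]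
  simp [inner_smul_left, inner_smul_right, hc]

lemma one_add_norm_pow_mul_norm_fourier_le {f : V → F} (hf : ContDiff ℝ ∞ f)
    (hint : ∀ j, Integrable (iteratedFDeriv ℝ j f)) (n : ℕ) (ξ : V) :
    (1 + ‖ξ‖) ^ n * ‖𝓕 f ξ‖ ≤
      4 ^ n * ∑ j ∈ Finset.range (n + 1), ∫ x, ‖iteratedFDeriv ℝ j f x‖ := by
  set S := ∑ j ∈ Finset.range (n + 1), ∫ x, ‖iteratedFDeriv ℝ j f x‖ with hS
  have hlow : ‖𝓕 f ξ‖ ≤ S := by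
    refine (norm_fourier_le_integral_norm f ξ).trans ?_
    simpa only [norm_iteratedFDeriv_zero] using
      Finset.single_le_sum (f := fun j => ∫ x, ‖iteratedFDeriv ℝ j f x‖)
        (fun _ _ => integral_nonneg fun _ => norm_nonneg _)
        (Finset.mem_range.2 (Nat.succ_pos n))
  have hhigh : ‖ξ‖ ^ n * ‖𝓕 f ξ‖ ≤ 2 ^ n * S := by
    have hmoment (k j : ℕ) (hk : (k : ℕ∞) ≤ 0) (_ : (j : ℕ∞) ≤ ⊤) :
        Integrable fun x => ‖x‖ ^ k * ‖iteratedFDeriv ℝ j f x‖ := by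
      obtain rfl : k = 0 := by simpa using hk
      simpa using (hint j).norm
    simpa [Finset.sum_product, hS] using
      Real.pow_mul_norm_iteratedFDeriv_fourier_le (N := ⊤) hf hmoment (k := 0) (n := n) le_rfl
        le_top ξ
  rcases le_total ‖ξ‖ 1 with hξ | hξ
  · gcongr
    linarith
  · calc (1 + ‖ξ‖) ^ n * ‖𝓕 f ξ‖
        ≤ (2 * ‖ξ‖) ^ n * ‖𝓕 f ξ‖ := by
          gcongr
          linarith
      _ = 2 ^ n * (‖ξ‖ ^ n * ‖𝓕 f ξ‖) := by rw [mul_pow, mul_assoc]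
      _ ≤ 2 ^ n * (2 ^ n * S) := by gcongr
      _ = 4 ^ n * S := by
          rw [← mul_assoc, ← mul_pow]
          norm_num

lemma integral_norm_le_of_forall_mem_norm_le {X E : Type*} [TopologicalSpace X] [MeasurableSpace X]
    {μ : Measure X} [IsFiniteMeasureOnCompacts μ] [NormedAddCommGroup E] {g : X → E} {t : Set X}
    {B : ℝ} (ht : IsCompact t) (hg : ∀ x ∉ t, g x = 0) (hB : ∀ x ∈ t, ‖g x‖ ≤ B) :
    ∫ x, ‖g x‖ ∂μ ≤ B * μ.real t := by
  rw [← setIntegral_eq_integral_of_forall_compl_eq_zero fun x hx => by rw [hg x hx, norm_zero]]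
  exact (Real.le_norm_self _).trans (norm_setIntegral_le_of_norm_le_const ht.measure_lt_top
    fun x hx => by simpa using hB x hx)

lemma exists_one_add_norm_pow_mul_norm_fourier_sub_le {P : Type*} [NormedAddCommGroup P]
    [NormedSpace ℝ P] {K : P × V → F} (hK : ContDiff ℝ ∞ K) {s : Set P} {t : Set V}
    (hs : IsCompact s) (ht : IsCompact t) (hKt : ∀ a ∈ s, ∀ x ∉ t, K (a, x) = 0) (n : ℕ) :
    ∃ C, 0 ≤ C ∧ ∀ a ∈ s, ∀ b ∈ s, ∀ ξ,
      (1 + ‖ξ‖) ^ n * ‖𝓕 (fun x => K (a, x) - K (b, x)) ξ‖ ≤ C * ‖a - b‖ := by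
  obtain ⟨C, hC₀, hC⟩ := exists_norm_iteratedFDeriv_comp_prodMk_sub_le hK hs ht n
  refine ⟨4 ^ n * ((n + 1) * (C * volume.real t)), by positivity, fun a ha b hb ξ => ?_⟩
  set f : V → F := fun x => K (a, x) - K (b, x)
  have hf : ContDiff ℝ ∞ f := by fun_prop
  have hft : tsupport f ⊆ t := closure_minimal (fun x hx => by
    by_contra hxt
    exact hx (by simp [f, hKt a ha x hxt, hKt b hb x hxt])) ht.isClosed
  have hfc : HasCompactSupport f := ht.of_isClosed_subset (isClosed_tsupport f) hft
  have hzero (j : ℕ) (x : V) (hx : x ∉ t) : iteratedFDeriv ℝ j f x = 0 :=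
    Function.notMem_support.1 fun h => hx (hft (support_iteratedFDeriv_subset j h))
  have hderiv : ∀ j ∈ Finset.range (n + 1),
      ∫ x, ‖iteratedFDeriv ℝ j f x‖ ≤ C * ‖a - b‖ * volume.real t := fun j hj =>
    integral_norm_le_of_forall_mem_norm_le ht (hzero j)
      (hC j (Finset.mem_range_succ_iff.1 hj) a ha b hb)
  calc (1 + ‖ξ‖) ^ n * ‖𝓕 f ξ‖
      ≤ 4 ^ n * ∑ j ∈ Finset.range (n + 1), ∫ x, ‖iteratedFDeriv ℝ j f x‖ :=
        one_add_norm_pow_mul_norm_fourier_le hf (fun j =>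
          (hf.continuous_iteratedFDeriv (mod_cast le_top)).integrable_of_hasCompactSupport
            (hfc.iteratedFDeriv j)) n ξ
    _ ≤ 4 ^ n * ((n + 1 : ℕ) • (C * ‖a - b‖ * volume.real t)) := by
        gcongr
        simpa using Finset.sum_le_card_nsmul _ _ _ hderiv
    _ = 4 ^ n * ((n + 1) * (C * volume.real t)) * ‖a - b‖ := by
        rw [nsmul_eq_mul]
        push_cast
        ring

end Fourier

section PowerDiff

section DyadicDefect

variable {V F : Type*} [NormedAddCommGroup V] [NormedAddCommGroup F] [NormedSpace ℝ F]

/-- `x ↦ (|x| ^ a - |x| ^ m) Φ(x)` for a vector-valued cutoff `Φ`. -/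
noncomputable def powerDiffSMul (m : ℕ) (Φ : V → F) (a : ℝ) : V → F :=
  fun x => (‖x‖ ^ a - ‖x‖ ^ m) • Φ x

variable [NormedSpace ℝ V]

/-- The function `K(a, x) = |x| ^ a (Φ(x) - Φ(2x)) + 2 ^ (-a) |2x| ^ m Φ(2x)`, for which
`K(a, x) - K(m, x)` is the failure of `f = powerDiffSMul m Φ a` to satisfy `f(x) = 2 ^ (-a) f(2x)`.
It depends smoothly on `(a, x)` jointly when `Φ` is constant near the origin and `m` is even. -/
noncomputable def dyadicDefect (m : ℕ) (Φ : V → F) (z : ℝ × V) : F :=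
  ‖z.2‖ ^ z.1 • (Φ z.2 - Φ ((2 : ℝ) • z.2)) +
    ((2 : ℝ) ^ (-z.1) * ‖(2 : ℝ) • z.2‖ ^ m) • Φ ((2 : ℝ) • z.2)

lemma powerDiffSMul_eq_smul_dilation_add (m : ℕ) (Φ : V → F) (a : ℝ) (x : V) :
    powerDiffSMul m Φ a x = (2 : ℝ) ^ (-a) • powerDiffSMul m Φ a ((2 : ℝ) • x) +
      (dyadicDefect m Φ (a, x) - dyadicDefect m Φ ((m : ℝ), x)) := by
  have hscale (b : ℝ) : (2 : ℝ) ^ (-b) * ‖(2 : ℝ) • x‖ ^ b = ‖x‖ ^ b := by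
    rw [norm_smul, Real.norm_ofNat, Real.mul_rpow zero_le_two (norm_nonneg x),
      Real.rpow_neg zero_le_two, inv_mul_cancel_left₀ (by positivity)]
  have hscale_m := hscale m
  simp only [Real.rpow_natCast] at hscale_m
  simp only [powerDiffSMul, dyadicDefect, smul_smul, mul_sub, hscale, hscale_m, Real.rpow_natCast]
  module

lemma exists_isCompact_forall_notMem_dyadicDefect_eq_zero {Φ : V → F} (hΦc : HasCompactSupport Φ)
    (m : ℕ) : ∃ t : Set V, IsCompact t ∧ ∀ a, ∀ x ∉ t, dyadicDefect m Φ (a, x) = 0 := by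
  have hdil : HasCompactSupport fun x => Φ ((2 : ℝ) • x) := hΦc.comp_smul two_ne_zero
  refine ⟨_, IsCompact.union hΦc hdil, fun a x hx => ?_⟩
  rw [mem_union, not_or] at hx
  have h₁ : Φ x = 0 := image_eq_zero_of_notMem_tsupport hx.1
  have h₂ : Φ ((2 : ℝ) • x) = 0 :=
    image_eq_zero_of_notMem_tsupport (f := fun x => Φ ((2 : ℝ) • x)) hx.2
  simp [dyadicDefect, h₁, h₂]

end DyadicDefect

section Smoothness

lemma eventuallyEq_sub_comp_smul_zero {V F : Type*} [NormedAddCommGroup V] [NormedSpace ℝ V]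
    [AddGroup F] {Φ : V → F} (hΦ : EventuallyConst Φ (𝓝 0)) (c : ℝ) :
    (fun x => Φ x - Φ (c • x)) =ᶠ[𝓝 0] 0 := by
  obtain ⟨v, hv⟩ := eventuallyConst_iff_exists_eventuallyEq.1 hΦ
  have hdil : Tendsto (fun x : V => c • x) (𝓝 0) (𝓝 0) := by
    simpa using (continuous_const_smul c).tendsto (0 : V)
  filter_upwards [hv, hdil.eventually hv] with x hx hcx
  simp [hx, hcx]

variable {V F : Type*} [NormedAddCommGroup V] [InnerProductSpace ℝ V] [NormedAddCommGroup F]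
  [NormedSpace ℝ F] {Φ : V → F} {m : ℕ}

lemma contDiff_norm_pow_of_even (hm : Even m) : ContDiff ℝ ∞ fun x : V => ‖x‖ ^ m := by
  obtain ⟨k, rfl⟩ := hm.exists_two_nsmul
  simpa only [smul_eq_mul, pow_mul] using (contDiff_norm_sq ℝ).pow k

lemma contDiff_norm_rpow_smul_of_eventuallyEq_zero {g : V → F} (hg : ContDiff ℝ ∞ g)
    (hg₀ : g =ᶠ[𝓝 0] 0) : ContDiff ℝ ∞ fun z : ℝ × V => ‖z.2‖ ^ z.1 • g z.2 := by
  refine contDiff_iff_contDiffAt.2 fun ⟨a, x⟩ => ?_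
  rcases eq_or_ne x 0 with rfl | hx
  · have hzero : (fun z : ℝ × V => ‖z.2‖ ^ z.1 • g z.2) =ᶠ[𝓝 (a, 0)] fun _ => 0 := by
      filter_upwards [continuousAt_snd.eventually hg₀] with z hz
      rw [hz, Pi.zero_apply, smul_zero]
    exact contDiffAt_const.congr_of_eventuallyEq hzero
  · exact ((contDiffAt_snd.norm ℝ hx).rpow contDiffAt_fst (norm_ne_zero_iff.2 hx)).smul
      (hg.contDiffAt.comp (a, x) contDiffAt_snd)

lemma contDiff_dyadicDefect (hm : Even m) (hΦ : ContDiff ℝ ∞ Φ)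
    (hΦ₀ : EventuallyConst Φ (𝓝 0)) : ContDiff ℝ ∞ (dyadicDefect m Φ) := by
  have hshell : ContDiff ℝ ∞ fun z : ℝ × V => ‖z.2‖ ^ z.1 • (Φ z.2 - Φ ((2 : ℝ) • z.2)) :=
    contDiff_norm_rpow_smul_of_eventuallyEq_zero (by fun_prop)
      (eventuallyEq_sub_comp_smul_zero hΦ₀ 2)
  have hexp : ContDiff ℝ ∞ fun z : ℝ × V => (2 : ℝ) ^ (-z.1) :=
    contDiff_const.rpow contDiff_fst.neg fun _ => two_ne_zero
  have hpow : ContDiff ℝ ∞ fun z : ℝ × V => ‖(2 : ℝ) • z.2‖ ^ m :=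
    (contDiff_norm_pow_of_even hm).comp (contDiff_const.smul contDiff_snd)
  have hdil : ContDiff ℝ ∞ fun z : ℝ × V => Φ ((2 : ℝ) • z.2) := by fun_prop
  exact hshell.add ((hexp.mul hpow).smul hdil)

end Smoothness

section FourierDecay

variable {V F : Type*} [NormedAddCommGroup V] [InnerProductSpace ℝ V] [FiniteDimensional ℝ V]
  [MeasurableSpace V] [BorelSpace V] [NormedAddCommGroup F] [NormedSpace ℂ F] {Φ : V → F} {m : ℕ}

lemma integrable_powerDiffSMul (hΦ : Continuous Φ) (hΦc : HasCompactSupport Φ) {a : ℝ}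
    (ha : 0 ≤ a) : Integrable (powerDiffSMul m Φ a) := by
  have hcont : Continuous (powerDiffSMul m Φ a) :=
    ((continuous_norm.rpow_const fun _ => Or.inr ha).sub (continuous_norm.pow m)).smul hΦ
  exact hcont.integrable_of_hasCompactSupport hΦc.smul_left

lemma fourier_powerDiffSMul_recursion (hΦ : Continuous Φ) (hΦc : HasCompactSupport Φ) {a : ℝ}
    (ha : 0 ≤ a) (ξ : V) :
    𝓕 (powerDiffSMul m Φ a) ξ =
      (2 : ℝ) ^ (-(finrank ℝ V + a)) • 𝓕 (powerDiffSMul m Φ a) ((2 : ℝ)⁻¹ • ξ) +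
        𝓕 (fun x => dyadicDefect m Φ (a, x) - dyadicDefect m Φ ((m : ℝ), x)) ξ := by
  set f := powerDiffSMul m Φ a
  have hf : Integrable f := integrable_powerDiffSMul hΦ hΦc ha
  have hsum : f = (2 : ℝ) ^ (-a) • (fun x => f ((2 : ℝ) • x)) +
      fun x => dyadicDefect m Φ (a, x) - dyadicDefect m Φ ((m : ℝ), x) :=
    funext (powerDiffSMul_eq_smul_dilation_add m Φ a)
  have hdil : Integrable ((2 : ℝ) ^ (-a) • fun x => f ((2 : ℝ) • x)) :=
    (hf.comp_smul two_ne_zero).smul _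
  have hdefect : Integrable fun x => dyadicDefect m Φ (a, x) - dyadicDefect m Φ ((m : ℝ), x) := by
    rw [eq_sub_of_add_eq' hsum.symm]
    exact hf.sub hdil
  have hcoeff : (2 : ℝ) ^ (-a) * |((2 : ℝ) ^ finrank ℝ V)⁻¹| = 2 ^ (-(finrank ℝ V + a)) := by
    rw [abs_of_pos (by positivity), ← Real.rpow_natCast, ← Real.rpow_neg zero_le_two,
      ← Real.rpow_add zero_lt_two]
    ring_nf
  conv_lhs => rw [hsum]
  rw [fourier_add_apply hdil hdefect, fourier_real_smul_apply, fourier_comp_smul_apply two_ne_zero,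
    smul_smul, hcoeff]

lemma exists_norm_fourier_powerDiffSMul_le [Nontrivial V] (hm : Even m) (hΦ : ContDiff ℝ ∞ Φ)
    (hΦc : HasCompactSupport Φ) (hΦ₀ : EventuallyConst Φ (𝓝 0)) (A : ℝ) :
    ∃ C, 0 < C ∧ ∀ a ∈ Icc 0 A, ∀ ξ,
      ‖𝓕 (powerDiffSMul m Φ a) ξ‖ ≤ C * |a - m| * (1 + ‖ξ‖) ^ (-(finrank ℝ V : ℝ) - a) := by
  obtain ⟨t, ht, hzero⟩ := exists_isCompact_forall_notMem_dyadicDefect_eq_zero hΦc m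
  obtain ⟨C, hC₀, hC⟩ := exists_one_add_norm_pow_mul_norm_fourier_sub_le
    (contDiff_dyadicDefect hm hΦ hΦ₀) (isCompact_Icc (a := 0) (b := max A m)) ht
    (fun a _ => hzero a) ⌈finrank ℝ V + A + 1⌉₊
  refine ⟨2 * (C + 1), by positivity, fun a ha ξ => ?_⟩
  have hdim : (1 : ℝ) ≤ finrank ℝ V := mod_cast finrank_pos (R := ℝ) (M := V)
  have hbdd : BddAbove (range fun ξ => ‖𝓕 (powerDiffSMul m Φ a) ξ‖) :=
    ⟨_, forall_mem_range.2 (norm_fourier_le_integral_norm _)⟩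
  have hdefect (ξ : V) :
      ‖𝓕 (fun x => dyadicDefect m Φ (a, x) - dyadicDefect m Φ ((m : ℝ), x)) ξ‖ ≤
        C * |a - m| * (1 + ‖ξ‖) ^ (-(finrank ℝ V + a) - 1) := by
    rw [← neg_add']
    exact le_mul_rpow_neg_of_pow_mul_le (le_add_of_nonneg_right (norm_nonneg ξ)) (norm_nonneg _)
      (le_trans (by linarith [ha.2]) (Nat.le_ceil _))
      (hC a ⟨ha.1, ha.2.trans (le_max_left _ _)⟩ m ⟨m.cast_nonneg, le_max_right _ _⟩ ξ)
  have hrec (ξ : V) : ‖𝓕 (powerDiffSMul m Φ a) ξ‖ ≤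
      2 ^ (-(finrank ℝ V + a)) * ‖𝓕 (powerDiffSMul m Φ a) ((2 : ℝ)⁻¹ • ξ)‖ +
        C * |a - m| * (1 + ‖ξ‖) ^ (-(finrank ℝ V + a) - 1) := by
    rw [fourier_powerDiffSMul_recursion hΦ.continuous hΦc ha.1 ξ]
    refine (norm_add_le _ _).trans (add_le_add ?_ (hdefect ξ))
    rw [norm_smul, Real.norm_of_nonneg (by positivity)]
  calc ‖𝓕 (powerDiffSMul m Φ a) ξ‖
      ≤ 2 * (C * |a - m|) * (1 + ‖ξ‖) ^ (-(finrank ℝ V + a)) :=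
        le_of_dyadic_recursion (by linarith [ha.1]) (by positivity) hbdd hrec ξ
    _ ≤ 2 * (C + 1) * |a - m| * (1 + ‖ξ‖) ^ (-(finrank ℝ V : ℝ) - a) := by
        rw [neg_add', ← mul_assoc]
        gcongr
        linarith

theorem lemma5p1_general [Nontrivial V] (hm : Even m) (hΦ : ContDiff ℝ ∞ Φ)
    (hΦc : HasCompactSupport Φ) (hΦ₀ : EventuallyConst Φ (𝓝 0)) :
    ∃ η : ℝ → ℝ,
      (∀ a : ℝ, 0 ≤ a → a ≠ m → 0 < η a ∧
        ∀ ξ : V, ‖𝓕 (powerDiffSMul m Φ a) ξ‖ ≤ η a * (1 + ‖ξ‖) ^ (-(finrank ℝ V : ℝ) - a)) ∧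
      η =O[𝓝 (m : ℝ)] (fun a : ℝ => a - m) := by
  choose C hC₀ hC using exists_norm_fourier_powerDiffSMul_le hm hΦ hΦc hΦ₀
  refine ⟨fun a => C (max a (m + 1)) * |a - m|, fun a ha ham => ⟨?_, ?_⟩, ?_⟩
  · exact mul_pos (hC₀ _) (abs_pos.2 (sub_ne_zero.2 ham))
  · exact hC _ a ⟨ha, le_max_left _ _⟩
  · refine Asymptotics.IsBigO.of_bound (C (m + 1)) ?_
    filter_upwards [eventually_lt_nhds (lt_add_one (m : ℝ))] with a ha
    rw [max_eq_right ha.le, norm_mul, Real.norm_of_nonneg (hC₀ _).le, Real.norm_eq_abs, abs_abs,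
      Real.norm_eq_abs]

end FourierDecay

end PowerDiff

section Truncation

variable {d : ℕ} {Φ : EuclideanSpace ℝ (Fin d) → ℝ}

lemma IsTruncationFunction.hasCompactSupport (hΦ : IsTruncationFunction Φ) :
    HasCompactSupport Φ :=
  (isCompact_closedBall 0 2).of_isClosed_subset (isClosed_tsupport Φ) hΦ.tsupport_subset

lemma IsTruncationFunction.eventuallyConst (hΦ : IsTruncationFunction Φ) :
    EventuallyConst Φ (𝓝 0) :=
  eventuallyConst_iff_exists_eventuallyEq.2
    ⟨1, eventually_of_mem (ball_mem_nhds 0 one_pos) hΦ.eq_one⟩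

lemma truncatedPowerDiff_eq_powerDiffSMul (Φ : EuclideanSpace ℝ (Fin d) → ℝ) :
    truncatedPowerDiff Φ = powerDiffSMul 4 (Complex.ofReal ∘ Φ) := by
  ext a x
  simp [truncatedPowerDiff, powerDiffSMul]

end Truncation

theorem lemma5p1 (d : ℕ) (hd : 1 ≤ d) (Φ : EuclideanSpace ℝ (Fin d) → ℝ)
    (hΦ : IsTruncationFunction Φ) :
    ∃ η : ℝ → ℝ,
      (∀ a : ℝ, 4 < a → 0 < η a ∧
        ∀ ξ : EuclideanSpace ℝ (Fin d),
          ‖𝓕 (truncatedPowerDiff Φ a) ξ‖ ≤ η a * (1 + ‖ξ‖) ^ (-(d : ℝ) - a)) ∧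
      η =O[𝓝[>] (4 : ℝ)] (fun a : ℝ => a - 4) := by
  have : Nonempty (Fin d) := ⟨0, hd⟩
  obtain ⟨η, hη, hO⟩ := lemma5p1_general (m := 4) (Φ := Complex.ofReal ∘ Φ) (by decide)
    (Complex.ofRealCLM.contDiff.comp hΦ.smooth) (hΦ.hasCompactSupport.comp_left Complex.ofReal_zero)
    (hΦ.eventuallyConst.comp Complex.ofReal)
  rw [finrank_euclideanSpace_fin, ← truncatedPowerDiff_eq_powerDiffSMul] at hη
  exact ⟨η, fun a ha => hη a (by linarith) (mod_cast ha.ne'),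
    (mod_cast hO : η =O[𝓝 (4 : ℝ)] fun a => a - 4).mono nhdsWithin_le_nhds⟩
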